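/- Let $N\ge 1$, let $f(z)=\sum_{l\ge 1}a(l)e^{2\pi i l z}$ be a cusp form of weight $2$ for $\Gamma_0(N)$, and let $\chi$ be a primitive Dirichlet character modulo $N$ with $\chi(-1)=1$. Put $$\sigma^{\chi}_{w}(m)=\sum_{d\mid m,\ d>0}\chi(d)d^{w}\quad(m\ge 1),\qquad W(\bar\chi)=\sum_{a \bmod N}\bar\chi(a)e^{2\pi i a/N},$$ let $L(\bar\chi,\cdot)$ be the Dirichlet $L$-function of $\bar\chi$, and for integers $c>0$ with $N\mid c$ and $d$ with $(d,c)=1$ let $$\Lambda\!\left(f,t,-\tfrac dc\right)=c^{t}\int_0^\infty f\!\left(-\tfrac dc+ix\right)x^{t}\,\frac{dx}{x}\qquad(t\in\mathbb C),$$ which for large $\mathrm{Re}(t)$ is $\left(\frac{c}{2\pi}\right)^{t}\Gamma(t)\sum_{l\ge1}a(l)e^{-2\pi i l d/c}\,l^{-t}$. Fix $n\in\mathbb Z$ and $s\in\mathbb C$ with $\mathrm{Re}(s)>2$. (i) The series $$\sum_{\substack{l\ge 1,\ m\ne 0\\ l-m=n}}\frac{a(l)\,\sigma^{\chi}_{2s-1}(|m|)}{l^{t}|m|^{2s-1}}=\sum_{l\ge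 1,\ l\ne n}\frac{a(l)\,\sigma^{\chi}_{2s-1}(|l-n|)}{l^{t}|l-n|^{2s-1}}$$ converges absolutely for $\mathrm{Re}(t)>3/2$, and as a function of $t$ it has an analytic continuation to the half-plane $\mathrm{Re}(t)>1/2-\delta$ for some $\delta>0$. (ii) The number $\delta>0$ can be chosen so that, for every $t$ with $\mathrm{Re}(t)>1/2-\delta$, the continued function equals $$N^{2s}\,\frac{L(\bar\chi,2s)}{W(\bar\chi)}\,\frac{(2\pi)^{t}}{\Gamma(t)}\sum_{\substack{c>0\\ N\mid c}}c^{-2s-t}\sum_{\substack{d \bmod c\\ (d,c)=1}}\overline{\chi(d)}\,e^{2\pi i n d/c}\,\Lambda\!\left(f,t,-\tfrac dc\right),$$ where the sum over $c$ converges absolutely and $1/\Gamma(t)$ is read as $0$ at the poles of $\Gamma$. -/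

import Mathlib

open Complex
open scoped MatrixGroups

noncomputable section

namespace ShiftedConvolution

/-- The space `S₂(Γ₀(N))` of holomorphic cusp forms of weight `2` for `Γ₀(N)`. -/
abbrev CuspFormsWeightTwo (N : ℕ) : Type :=
  CuspForm (CongruenceSubgroup.Gamma0 N : Subgroup (GL (Fin 2) ℝ)) 2

/-- The Fourier coefficient `a(l)` in `f(z) = ∑_{l ≥ 1} a(l) e^{2πilz}`. -/
def fourierCoeff {N : ℕ} (f : CuspFormsWeightTwo N) (l : ℕ) : ℂ :=
  (UpperHalfPlane.qExpansion 1 f).coeff l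

/-- The twisted divisor sum `σ_w^χ(m) = ∑_{d ∣ m} χ(d) d^w`, over the positive divisors of `m`. -/
def twistedSigma {N : ℕ} (χ : DirichletCharacter ℂ N) (w : ℂ) (m : ℕ) : ℂ :=
  ∑ d ∈ m.divisors, χ (d : ZMod N) * (d : ℂ) ^ w

/-- The term `a(l) σ^χ_{2s-1}(|m|) / (l^t |m|^{2s-1})` of the double Dirichlet series. -/
def shiftedTerm {N : ℕ} (f : CuspFormsWeightTwo N) (χ : DirichletCharacter ℂ N) (s t : ℂ)
    (l : ℕ) (m : ℤ) : ℂ :=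
  fourierCoeff f l * twistedSigma χ (2 * s - 1) m.natAbs /
    ((l : ℂ) ^ t * (m.natAbs : ℂ) ^ (2 * s - 1))

/-- The pairs `(l, m)` with `l ≥ 1`, `m ≠ 0` and `l - m = n`. -/
abbrev ShiftPair (n : ℤ) : Type :=
  {p : ℕ × ℤ // 1 ≤ p.1 ∧ p.2 ≠ 0 ∧ (p.1 : ℤ) - p.2 = n}

/-- The completed additive twist
`Λ(f, t, -d/c) = (c/2π)^t Γ(t) ∑_{l ≥ 1} a(l) e^{-2πild/c} l^{-t}`, for all `t` through
`Λ(f, t, -d/c) = c^t ∫₀^∞ f(-d/c + ix) x^t dx/x`. -/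
def completedTwist {N : ℕ} (f : CuspFormsWeightTwo N) (t : ℂ) (c d : ℕ) : ℂ :=
  (c : ℂ) ^ t *
    ∫ x : ℝ in Set.Ioi 0,
      f (UpperHalfPlane.ofComplex (-((d : ℂ) / (c : ℂ)) + I * (x : ℂ))) * (x : ℂ) ^ (t - 1)

/-- The Gauss sum `W(χ) = ∑_{a mod N} χ(a) e^{2πia/N}`. -/
def gaussW {N : ℕ} [NeZero N] (χ : DirichletCharacter ℂ N) : ℂ :=
  gaussSum χ ZMod.stdAddChar

/-- The moduli `c > 0` with `N ∣ c`. -/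
abbrev Modulus (N : ℕ) : Type := {c : ℕ // 0 < c ∧ N ∣ c}

/-- The term
`c^{-2s-t} ∑_{d mod c, (d, c) = 1} conj(χ(d)) e^{2πind/c} Λ(f, t, -d/c)`. -/
def modulusTerm {N : ℕ} (f : CuspFormsWeightTwo N) (χ : DirichletCharacter ℂ N) (n : ℤ)
    (s t : ℂ) (c : ℕ) : ℂ :=
  (c : ℂ) ^ (-2 * s - t) *
    ∑ d ∈ (Finset.range c).filter (fun d => Nat.Coprime d c),
      (starRingEnd ℂ) (χ (d : ZMod N)) *
        exp (2 * Real.pi * I * (n : ℂ) * ((d : ℂ) / (c : ℂ))) * completedTwist f t c d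

end ShiftedConvolution

end

/-!
For `Re w > 2`, a primitive even character `χ` modulo `N` and `m ≠ 0`, the twisted divisor sum has
the Ramanujan expansion
`W(χ̄) σ^χ_{w-1}(|m|) / |m|^{w-1} = L(χ̄, w) ∑_{k ≥ 1} k^{-w} ∑_{d mod Nk, (d, Nk) = 1} χ̄(d) e(md/Nk)`.
Indeed, the product on the right is a Dirichlet convolution whose coefficients are the complete sums
`∑_{d mod Nq} χ̄(d) e(md/Nq)` (`completeSum_eq_convolution`), and these equal `q χ(m/q) W(χ̄)` or `0`
according to whether `q` divides `m` (`completeSum_mul`). See `LFunction_mul_LSeries_ramanujanSum`.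
The expansion persists at `m = 0` with both sides zero when `N ≠ 1`; when `N = 1` there is no nonzero
cusp form of weight two (`fourierCoeff_eq_zero_of_level_one`), so the term `l = n` causes no trouble.

Inserting the expansion with `w = 2s` and `m = n - l`, and interchanging the sums over `l` and `c`
(`tsum_modulusTerm`), turns the inner sum over `l` into the Dirichlet series of the additive twists
of `f`, that is, into a Mellin transform of `f` along the vertical line above `-d/c`
(`hasSum_mellin_verticalLine`). The interchange is licit for `Re t > 3/2`: Parseval on horizontal
lines and the bound `f = O(1/y)` give `∑_{l ≤ X} |a(l)|² = O(X²)`, hence `∑_{l ≤ X} |a(l)| = O(X^{3/2})`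
by Cauchy-Schwarz.

The continuation is the sum over `c` itself. A matrix in `Γ₀(N)` with lower row `(c, d)` maps the
vertical line above `-d/c` to the one above another rational, exchanging its ends, so that
`f(-d/c + ix) = O(c²)` uniformly (`exists_norm_verticalLine_le_sq`), while `f(-d/c + ix) = O(x^{-A})`
for every `A ≥ 1`. Therefore the Mellin transforms are holomorphic and `O(c²)` locally uniformly on
`Re t > 0`, and the sum over `c` is dominated by `∑ c^{3 - 2 Re s}`, which converges as `Re s > 2`.
-/

namespace ShiftedConvolution

open Filter MeasureTheory Asymptotics
open scoped Topology UpperHalfPlane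

/-! ### Bounds for weight two cusp forms -/

section CuspFormBounds

variable {N : ℕ} [NeZero N] (f : CuspFormsWeightTwo N)

lemma one_mem_strictPeriods_Gamma0 (N : ℕ) :
    (1 : ℝ) ∈ (CongruenceSubgroup.Gamma0 N : Subgroup (GL (Fin 2) ℝ)).strictPeriods := by
  simp

lemma exists_norm_le_div_im : ∃ C : ℝ, 0 ≤ C ∧ ∀ τ : ℍ, ‖f τ‖ ≤ C / τ.im := by
  obtain ⟨C, hC⟩ := CuspFormClass.exists_bound f
  refine ⟨C, ?_, fun τ ↦ by simpa using hC τ⟩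
  have h := (norm_nonneg _).trans (hC UpperHalfPlane.I)
  simpa using h

/-- A weight two cusp form decays faster than any power of `im τ`, uniformly in `re τ`: near the
cusp `∞` the decay is exponential, and elsewhere `f = O(1 / im τ)` suffices as `1 ≤ A`. -/
lemma exists_norm_le_im_rpow_neg {A : ℝ} (hA : 1 ≤ A) :
    ∃ C : ℝ, 0 ≤ C ∧ ∀ τ : ℍ, ‖f τ‖ ≤ C * τ.im ^ (-A) := by
  obtain ⟨C₁, hC₁, h₁⟩ := exists_norm_le_div_im f
  have hexp := CuspFormClass.exp_decay_atImInfty f one_pos (one_mem_strictPeriods_Gamma0 N)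
  have hdec : (fun τ : ℍ ↦ Real.exp (-2 * Real.pi * τ.im / 1)) =O[UpperHalfPlane.atImInfty]
      fun τ ↦ τ.im ^ (-A) := by
    have := (isLittleO_exp_neg_mul_rpow_atTop (a := 2 * Real.pi) (by positivity) (-A)).isBigO
    have h2 := this.comp_tendsto
      (show Tendsto UpperHalfPlane.im UpperHalfPlane.atImInfty atTop from tendsto_comap)
    refine h2.congr_left fun τ ↦ ?_
    simp
  obtain ⟨C₂, hC₂⟩ := (hexp.trans hdec).bound
  obtain ⟨B, hB⟩ := (UpperHalfPlane.atImInfty_mem _).mp hC₂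
  set M : ℝ := max B 1 with hM
  have hM1 : 1 ≤ M := le_max_right _ _
  refine ⟨max C₂ (C₁ * M ^ (A - 1)), le_max_of_le_right (by positivity), fun τ ↦ ?_⟩
  have hτ := τ.im_pos
  -- The exponential bound is valid above height `M`; below it, `1 / y ≤ M ^ (A - 1) * y ^ (-A)`.
  rcases le_total M τ.im with h | h
  · have := hB τ ((le_max_left _ _).trans h)
    rw [Set.mem_ofPred_eq, Real.norm_of_nonneg (by positivity)] at this
    exact this.trans (by gcongr; exact le_max_left _ _)
  · refine (h₁ τ).trans ?_
    have hpow : τ.im ^ (A - 1) ≤ M ^ (A - 1) := Real.rpow_le_rpow hτ.le h (by linarith)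
    calc C₁ / τ.im = C₁ * τ.im ^ (A - 1) * τ.im ^ (-A) := by
          rw [mul_assoc, ← Real.rpow_add hτ, show A - 1 + -A = -1 by ring, Real.rpow_neg_one,
            div_eq_mul_inv]
      _ ≤ C₁ * M ^ (A - 1) * τ.im ^ (-A) := by gcongr
      _ ≤ _ := by gcongr; exact le_max_right _ _

end CuspFormBounds

section VerticalLine

variable {N : ℕ} (f : CuspFormsWeightTwo N)

/-- The value of `f` on the vertical line above `-d / c`, at height `x`. It is meaningful only for
`0 < x`, since `UpperHalfPlane.ofComplex` has a junk value off the upper half plane. -/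
noncomputable def verticalLine {N : ℕ} (f : CuspFormsWeightTwo N) (c d : ℕ) (x : ℝ) : ℂ :=
  f (UpperHalfPlane.ofComplex (-((d : ℂ) / (c : ℂ)) + I * (x : ℂ)))

/-- The point `-d / c + i x` of the upper half plane. -/
noncomputable def verticalPoint (c d : ℕ) {x : ℝ} (hx : 0 < x) : ℍ :=
  ⟨-((d : ℂ) / (c : ℂ)) + I * (x : ℂ), by simpa using hx⟩

lemma verticalPoint_im (c d : ℕ) {x : ℝ} (hx : 0 < x) : (verticalPoint c d hx).im = x := by
  simp [verticalPoint, ← UpperHalfPlane.coe_im]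

lemma verticalLine_eq (c d : ℕ) {x : ℝ} (hx : 0 < x) :
    verticalLine f c d x = f (verticalPoint c d hx) :=
   congrArg f (UpperHalfPlane.ofComplex_apply_of_im_pos (verticalPoint c d hx).im_pos)

lemma continuousOn_verticalLine (c d : ℕ) :
    ContinuousOn (verticalLine f c d) (Set.Ioi 0) := by
  have hd : Continuous (fun x : Set.Ioi (0 : ℝ) ↦ verticalPoint c d x.2) := by
    rw [UpperHalfPlane.isEmbedding_coe.continuous_iff]
    change Continuous fun x : Set.Ioi (0 : ℝ) ↦ (-((d : ℂ) / (c : ℂ)) + I * ((x : ℝ) : ℂ))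
    fun_prop
  rw [continuousOn_iff_continuous_domRestrict]
  have hf : Continuous f := (CuspFormClass.holo f).continuous
  exact (hf.comp hd).congr fun x ↦ (verticalLine_eq f c d x.2).symm

/-- Some `γ = (a b; c d) ∈ Γ₀(N)` sends `-d / c + i x` to a point of height `1 / (c² x)`, and
`f|γ = f`, so that the decay of `f` towards `∞` bounds `f` near the cusp `-d / c`. -/
lemma exists_norm_verticalLine_le_sq [NeZero N] : ∃ C : ℝ, 0 ≤ C ∧ ∀ c d : ℕ, 0 < c → N ∣ c →
    Nat.Coprime d c → ∀ x : ℝ, 0 < x → ‖verticalLine f c d x‖ ≤ C * (c : ℝ) ^ 2 := by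
  obtain ⟨C, hC, hf⟩ := exists_norm_le_im_rpow_neg f (A := 2) (by norm_num)
  refine ⟨C, hC, fun c d hc hN hcd x hx ↦ ?_⟩
  have hc' : (c : ℂ) ≠ 0 := by exact_mod_cast hc.ne'
  have hcop : IsCoprime (c : ℤ) (d : ℤ) := (Nat.isCoprime_iff_coprime.mpr hcd).symm
  obtain ⟨u, v, huv⟩ := hcop
  let γ : SL(2, ℤ) := ⟨!![v, -u; (c : ℤ), (d : ℤ)], by
    rw [Matrix.det_fin_two_of]; linarith⟩
  have hγ : γ ∈ CongruenceSubgroup.Gamma0 N := by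
    rw [CongruenceSubgroup.Gamma0_mem]
    change (((c : ℤ)) : ZMod N) = 0
    rw [Int.cast_natCast]
    exact (ZMod.natCast_eq_zero_iff _ _).mpr hN
  set z := verticalPoint c d hx with hz
  have hden : UpperHalfPlane.denom γ z = I * ((c * x : ℝ) : ℂ) := by
    have : (c : ℂ) * (-((d : ℂ) / (c : ℂ)) + I * (x : ℂ)) + d = I * ((c * x : ℝ) : ℂ) := by
      push_cast; field_simp; ring
    rw [← this, ModularGroup.denom_apply]
    simp [γ, hz, verticalPoint]
  have heq := SlashInvariantForm.slash_action_eqn_SL'' f hγ z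
  have him : (γ • z).im = 1 / (c ^ 2 * x) := by
    have h2 : (γ • z).im = z.im / Complex.normSq (UpperHalfPlane.denom γ z) := by
      simpa using ModularGroup.im_smul_eq_div_normSq γ z
    rw [h2, hden, hz, verticalPoint_im, Complex.normSq_mul, Complex.normSq_I, Complex.normSq_ofReal]
    field_simp
  have hb := hf (γ • z)
  rw [heq, hden, him, norm_mul] at hb
  rw [verticalLine_eq f c d hx, ← hz]
  have hcx : (0 : ℝ) < c * x := by positivity
  have hn : ‖(I * ((c * x : ℝ) : ℂ)) ^ (2 : ℤ)‖ = (c * x) ^ 2 := by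
    rw [norm_zpow, norm_mul, norm_I, one_mul, norm_real, Real.norm_of_nonneg hcx.le]
    norm_cast
  rw [hn] at hb
  have hr : (1 / ((c : ℝ) ^ 2 * x)) ^ (-2 : ℝ) = ((c : ℝ) ^ 2 * x) ^ 2 := by
    rw [one_div, Real.inv_rpow (by positivity), Real.rpow_neg (by positivity), inv_inv]
    norm_cast
  rw [hr] at hb
  have : (c * x) ^ 2 * ‖f z‖ ≤ (c * x) ^ 2 * (C * c ^ 2) := by
    refine hb.trans (le_of_eq ?_); ring
  exact le_of_mul_le_mul_left this (by positivity)

end VerticalLine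

/-- There are no nonzero cusp forms of weight two and level one. -/
lemma fourierCoeff_eq_zero_of_level_one (f : CuspFormsWeightTwo 1) (l : ℕ) :
    fourierCoeff f l = 0 := by
  have h1 : (CongruenceSubgroup.Gamma0 1 : Subgroup (GL (Fin 2) ℝ)) = 𝒮ℒ := by
    have : CongruenceSubgroup.Gamma0 1 = ⊤ := by
      ext γ; simp [CongruenceSubgroup.Gamma0_mem, Subsingleton.elim _ (0 : ZMod 1)]
    rw [this, MonoidHom.range_eq_map]
  -- The equality of groups is not definitional, so the vanishing is transported along it.
  have key : ∀ (Γ : Subgroup (GL (Fin 2) ℝ)), Γ = 𝒮ℒ → ∀ g : CuspForm Γ 2, (g : ℍ → ℂ) = 0 := by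
    rintro Γ rfl g
    have h0 := rank_zero_iff_forall_zero.mp
      (CuspForm.rank_eq_zero_of_weight_lt_twelve (k := 2) (by norm_num)) g
    simp [h0]
  rw [fourierCoeff, key _ h1 f, UpperHalfPlane.qExpansion_zero, map_zero]

/-! ### Mean square of the Fourier coefficients -/

section Coefficients

variable {N : ℕ} (f : CuspFormsWeightTwo N)

lemma fourierCoeff_zero : fourierCoeff f 0 = 0 :=
  CuspFormClass.qExpansion_coeff_zero f one_pos (one_mem_strictPeriods_Gamma0 N)

/-- On the horizontal line at height `y`, the numbers `a(l) e^{-2πly}` are Fourier coefficients. -/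
lemma fourierCoeffOn_horizontal {y : ℝ} (hy : 0 < y) (l : ℕ) :
    fourierCoeffOn (zero_lt_one' ℝ) (fun u : ℝ ↦ f (UpperHalfPlane.ofComplex (u + y * I))) l =
      fourierCoeff f l * Real.exp (-2 * Real.pi * l * y) := by
  rw [fourierCoeff, ModularFormClass.qExpansion_coeff_eq_intervalIntegral f one_pos
    (one_mem_strictPeriods_Gamma0 N) l hy, fourierCoeffOn_eq_integral]
  simp only [ofReal_one, div_one, one_mul, sub_zero, one_smul]
  rw [← intervalIntegral.integral_mul_const]
  refine intervalIntegral.integral_congr fun u _ ↦ ?_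
  have hpt : UpperHalfPlane.ofComplex ((u : ℂ) + y * I) = ⟨(u : ℂ) + y * I, by simpa using hy⟩ :=
    UpperHalfPlane.ofComplex_apply_of_im_pos _
  simp only [hpt, smul_eq_mul]
  rw [mul_right_comm, Function.Periodic.qParam, ← Complex.exp_nat_mul, one_div, ← Complex.exp_neg,
    ofReal_exp, ← Complex.exp_add]
  congr 1
  have h := fourier_coe_apply (T := (1 : ℝ) - 0) (n := -(l : ℤ)) (x := u)
  rw [h]
  congr 1
  push_cast
  ring_nf
  simp only [I_sq]
  ring

/-- Parseval on the line of height `1 / X`, where `|f| ≤ C X`. -/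
lemma exists_sum_sq_fourierCoeff_le [NeZero N] : ∃ C : ℝ, 0 ≤ C ∧ ∀ X : ℕ,
    ∑ l ∈ Finset.Icc 1 X, ‖fourierCoeff f l‖ ^ 2 ≤ C * (X : ℝ) ^ 2 := by
  obtain ⟨C, hC, hf⟩ := exists_norm_le_div_im f
  refine ⟨C ^ 2 * Real.exp (4 * Real.pi), by positivity, fun X ↦ ?_⟩
  rcases Nat.eq_zero_or_pos X with rfl | hX
  · simp
  have hX' : (0 : ℝ) < X := by exact_mod_cast hX
  set y : ℝ := 1 / X with hy
  have hy0 : 0 < y := by positivity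
  set g : ℝ → ℂ := fun u : ℝ ↦ f (UpperHalfPlane.ofComplex (u + y * I)) with hg
  have hpt (u : ℝ) : UpperHalfPlane.ofComplex ((u : ℂ) + y * I) =
      ⟨(u : ℂ) + y * I, by simpa using hy0⟩ :=
    UpperHalfPlane.ofComplex_apply_of_im_pos _
  have hgb (u : ℝ) : ‖g u‖ ≤ C * X := by
    have := hf (UpperHalfPlane.ofComplex (u + y * I))
    have him : (UpperHalfPlane.ofComplex ((u : ℂ) + y * I)).im = y := by
      rw [hpt, ← UpperHalfPlane.coe_im]; simp
    rw [him, hy, div_div_eq_mul_div, div_one] at this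
    exact this
  have hgc : Continuous g := by
    refine (CuspFormClass.holo f).continuous.comp ?_
    rw [UpperHalfPlane.isEmbedding_coe.continuous_iff]
    refine Continuous.congr (f := fun u : ℝ ↦ (u : ℂ) + y * I) (by fun_prop) fun u ↦ ?_
    simp [hpt]
  have hmem : MemLp g 2 (volume.restrict (Set.Ioc 0 1)) :=
    MemLp.of_bound hgc.aestronglyMeasurable (C * X) (Eventually.of_forall hgb)
  have hP := hasSum_sq_fourierCoeffOn (zero_lt_one' ℝ) hmem
  have hint : ((1 : ℝ) - 0)⁻¹ • ∫ x in (0 : ℝ)..1, ‖g x‖ ^ 2 ≤ (C * X) ^ 2 := by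
    rw [sub_zero, inv_one, one_smul]
    have : ∫ x in (0 : ℝ)..1, ‖g x‖ ^ 2 ≤ ∫ x in (0 : ℝ)..1, (C * X) ^ 2 := by
      refine intervalIntegral.integral_mono_on zero_le_one
        (Continuous.intervalIntegrable (by fun_prop) _ _) (by simp) fun u _ ↦ ?_
      have := hgb u
      gcongr
    simpa using this
  have hle := (sum_le_hasSum ((Finset.Icc 1 X).map Nat.castEmbedding)
    (fun i _ ↦ by positivity) hP).trans hint
  rw [Finset.sum_map] at hle
  -- The weight `e^{-4πly}` is at least `e^{-4π}` for `l ≤ X = 1 / y`.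
  have hterm : ∀ l ∈ Finset.Icc 1 X, ‖fourierCoeff f l‖ ^ 2 ≤
      Real.exp (4 * Real.pi) *
        ‖fourierCoeffOn (zero_lt_one' ℝ) g (Nat.castEmbedding l : ℤ)‖ ^ 2 := by
    intro l hl
    have hlX : (l : ℝ) * y ≤ 1 := by
      rw [hy, mul_one_div, div_le_one hX']
      exact_mod_cast (Finset.mem_Icc.mp hl).2
    rw [Nat.castEmbedding_apply, hg, fourierCoeffOn_horizontal f hy0 l, norm_mul, norm_real,
      Real.norm_of_nonneg (Real.exp_nonneg _), mul_pow, ← Real.exp_nat_mul, mul_left_comm,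
      ← Real.exp_add]
    refine le_mul_of_one_le_right (by positivity) (Real.one_le_exp ?_)
    push_cast
    nlinarith [Real.pi_pos]
  calc _ ≤ ∑ l ∈ Finset.Icc 1 X, Real.exp (4 * Real.pi) *
        ‖fourierCoeffOn (zero_lt_one' ℝ) g (Nat.castEmbedding l : ℤ)‖ ^ 2 :=
        Finset.sum_le_sum hterm
    _ ≤ Real.exp (4 * Real.pi) * (C * X) ^ 2 := by rw [← Finset.mul_sum]; gcongr
    _ = _ := by ring

/-- By Cauchy-Schwarz; the trivial bound `a(l) = O(l)` would only give the exponent `2`. -/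
lemma sum_norm_fourierCoeff_isBigO [NeZero N] :
    (fun X : ℕ ↦ ∑ l ∈ Finset.Icc 1 X, ‖fourierCoeff f l‖) =O[atTop]
      fun X : ℕ ↦ (X : ℝ) ^ (3 / 2 : ℝ) := by
  obtain ⟨C, hC, h⟩ := exists_sum_sq_fourierCoeff_le f
  refine IsBigO.of_bound (Real.sqrt C) (Eventually.of_forall fun X ↦ ?_)
  rw [Real.norm_of_nonneg (by positivity), Real.norm_of_nonneg (by positivity)]
  refine le_of_sq_le_sq ?_ (by positivity)
  have hCS := sq_sum_le_card_mul_sum_sq (s := Finset.Icc 1 X) (f := fun l ↦ ‖fourierCoeff f l‖)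
  rw [Nat.card_Icc, Nat.add_sub_cancel] at hCS
  have hp : ((X : ℝ) ^ (3 / 2 : ℝ)) ^ 2 = (X : ℝ) ^ 3 := by
    rw [← Real.rpow_natCast, ← Real.rpow_mul (by positivity), ← Real.rpow_natCast]
    norm_num
  rw [mul_pow, Real.sq_sqrt hC, hp]
  refine hCS.trans ?_
  calc (X : ℝ) * ∑ l ∈ Finset.Icc 1 X, ‖fourierCoeff f l‖ ^ 2 ≤ X * (C * (X : ℝ) ^ 2) := by
        gcongr; exact h X
    _ = _ := by ring

/-- Absolute convergence of `∑ a(l) l^{-t}` for `Re t > 3/2`. -/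
lemma summable_norm_fourierCoeff_div_rpow [NeZero N] {σ : ℝ} (hσ : 3 / 2 < σ) :
    Summable fun l : ℕ ↦ ‖fourierCoeff f l‖ / (l : ℝ) ^ σ := by
  have h : LSeriesSummable (fourierCoeff f) (σ : ℂ) :=
    LSeriesSummable_of_sum_norm_bigO (sum_norm_fourierCoeff_isBigO f) (by norm_num)
      (by simpa using hσ)
  refine h.norm.congr fun l ↦ ?_
  rcases eq_or_ne l 0 with rfl | hl
  · simp [fourierCoeff_zero]
  · rw [LSeries.norm_term_eq, if_neg hl, ofReal_re]

end Coefficients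

/-! ### Twisted Ramanujan sums -/

section RamanujanSums

variable {N : ℕ}

/-- The exponential `e(m d / c) = exp(2πi m d / c)`. -/
noncomputable def expFrac (m : ℤ) (d c : ℕ) : ℂ :=
  exp (2 * Real.pi * I * (m : ℂ) * ((d : ℂ) / (c : ℂ)))

/-- The twisted Ramanujan sum `∑_{d mod c, (d, c) = 1} ψ(d) e(m d / c)`. -/
noncomputable def ramanujanSum (ψ : DirichletCharacter ℂ N) (m : ℤ) (c : ℕ) : ℂ :=
  ∑ d ∈ (Finset.range c).filter (fun d => Nat.Coprime d c), ψ (d : ZMod N) * expFrac m d c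

/-- The complete sum `∑_{d mod c} ψ(d) e(m d / c)`. -/
noncomputable def completeSum (ψ : DirichletCharacter ℂ N) (m : ℤ) (c : ℕ) : ℂ :=
  ∑ d ∈ Finset.range c, ψ (d : ZMod N) * expFrac m d c

lemma norm_expFrac (m : ℤ) (d c : ℕ) : ‖expFrac m d c‖ = 1 := by
  have : 2 * (Real.pi : ℂ) * I * (m : ℂ) * ((d : ℂ) / (c : ℂ)) =
      ((2 * Real.pi * m * (d / c) : ℝ) : ℂ) * I := by push_cast; ring
  rw [expFrac, this, norm_exp_ofReal_mul_I]

lemma expFrac_mul_left (m : ℤ) (g d c : ℕ) (hg : g ≠ 0) :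
    expFrac m (g * d) (g * c) = expFrac m d c := by
  have : (g : ℂ) ≠ 0 := by exact_mod_cast hg
  rw [expFrac, expFrac]
  push_cast
  rw [mul_div_mul_left _ _ this]

lemma norm_ramanujanSum_le (ψ : DirichletCharacter ℂ N) (m : ℤ) (c : ℕ) :
    ‖ramanujanSum ψ m c‖ ≤ c := by
  refine (norm_sum_le_of_le _ (f := fun d : ℕ ↦ ψ (d : ZMod N) * expFrac m d c)
    (n := fun _ ↦ (1 : ℝ)) fun d _ ↦ ?_).trans ?_
  · rw [norm_mul, norm_expFrac, mul_one]
    exact ψ.norm_le_one _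
  · rw [Finset.sum_const, nsmul_eq_mul, mul_one]
    exact_mod_cast (Finset.card_filter_le _ _).trans (Finset.card_range c).le

/-- Orthogonality of the additive characters modulo `q`. -/
lemma sum_expFrac (m : ℤ) {q : ℕ} (hq : q ≠ 0) :
    ∑ b ∈ Finset.range q, expFrac m b q = if (q : ℤ) ∣ m then (q : ℂ) else 0 := by
  have hq' : (q : ℂ) ≠ 0 := by exact_mod_cast hq
  set z : ℂ := exp (2 * Real.pi * I * (m / q)) with hz
  have hpow (b : ℕ) : expFrac m b q = z ^ b := by
    rw [expFrac, hz, ← Complex.exp_nat_mul]; congr 1; ring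
  have hzq : z ^ q = 1 := by
    rw [hz, ← Complex.exp_nat_mul, Complex.exp_eq_one_iff]
    exact ⟨m, by field_simp⟩
  have hz1 : z = 1 ↔ (q : ℤ) ∣ m := by
    rw [hz, Complex.exp_eq_one_iff]
    constructor
    · rintro ⟨k, hk⟩
      refine ⟨k, ?_⟩
      have h2 : (2 * Real.pi * I : ℂ) ≠ 0 := Complex.two_pi_I_ne_zero
      rw [mul_comm (k : ℂ)] at hk
      have h3 := mul_left_cancel₀ h2 hk
      rw [div_eq_iff hq'] at h3
      have : (m : ℂ) = ((q * k : ℤ) : ℂ) := by rw [h3]; push_cast; ring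
      exact_mod_cast this
    · rintro ⟨k, rfl⟩
      exact ⟨k, by push_cast; field_simp⟩
  simp_rw [hpow]
  split_ifs with h
  · simp [hz1.mpr h]
  · have h1 : z - 1 ≠ 0 := sub_ne_zero.mpr fun h' ↦ h (hz1.mp h')
    have := mul_geom_sum z q
    rw [hzq, sub_self] at this
    exact (mul_eq_zero.mp this).resolve_left h1

lemma sum_range_mul_eq_sum_sum {M : Type*} [AddCommMonoid M] (g : ℕ → M) (N q : ℕ) :
    ∑ d ∈ Finset.range (N * q), g d =
      ∑ b ∈ Finset.range q, ∑ a ∈ Finset.range N, g (a + N * b) := by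
  induction q with
  | zero => simp
  | succ q ih =>
    rw [mul_add, mul_one, Finset.sum_range_add, Finset.sum_range_succ, ih]
    simp_rw [add_comm (N * q)]

lemma sum_range_natCast_zmod [NeZero N] {M : Type*} [AddCommMonoid M] (g : ZMod N → M) :
    ∑ a ∈ Finset.range N, g (a : ZMod N) = ∑ a : ZMod N, g a := by
  refine Finset.sum_nbij' (fun a ↦ (a : ZMod N)) ZMod.val (by simp) ?_ ?_ (by simp) (by simp)
  · intro a _
    exact Finset.mem_range.mpr (ZMod.val_lt a)
  · intro a ha
    exact ZMod.val_cast_of_lt (Finset.mem_range.mp ha)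

/-- A complete sum modulo `N q` of a primitive character modulo `N`: writing `d = a + N b`, the sum
over `b` detects `q ∣ m`, and the sum over `a` is a Gauss sum. -/
lemma completeSum_mul [NeZero N] {ψ : DirichletCharacter ℂ N} (hψ : ψ.IsPrimitive) (m : ℤ)
    {q : ℕ} (hq : q ≠ 0) :
    completeSum ψ m (N * q) =
      if (q : ℤ) ∣ m then (q : ℂ) * (ψ⁻¹ ((m / q : ℤ) : ZMod N) * gaussW ψ) else 0 := by
  have hN : (N : ℂ) ≠ 0 := by exact_mod_cast NeZero.ne N
  have hq' : (q : ℂ) ≠ 0 := by exact_mod_cast hq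
  have hsplit (a b : ℕ) : ψ ((a + N * b : ℕ) : ZMod N) * expFrac m (a + N * b) (N * q) =
      ψ (a : ZMod N) * expFrac m a (N * q) * expFrac m b q := by
    have : ((a + N * b : ℕ) : ZMod N) = a := by simp
    rw [this, mul_assoc]
    congr 1
    rw [expFrac, expFrac, expFrac, ← Complex.exp_add]
    congr 1
    push_cast
    field_simp
  rw [completeSum, sum_range_mul_eq_sum_sum]
  simp_rw [hsplit, ← Finset.sum_mul]
  rw [← Finset.mul_sum, sum_expFrac m hq]
  split_ifs with h
  · obtain ⟨k, rfl⟩ := h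
    rw [Int.mul_ediv_cancel_left _ (by exact_mod_cast hq), mul_comm, gaussW,
      ← gaussSum_mulShift_of_isPrimitive _ hψ, gaussSum, ← sum_range_natCast_zmod]
    congr 1
    refine Finset.sum_congr rfl fun a _ ↦ ?_
    congr 1
    have : (k : ZMod N) * (a : ZMod N) = ((k * a : ℤ) : ZMod N) := by push_cast; rfl
    rw [AddChar.mulShift_apply, this, ZMod.stdAddChar_coe, expFrac]
    congr 1
    push_cast
    field_simp
  · rw [mul_zero]

/-- Sorting the residues `d` modulo `N q` by `gcd(d, q)` expresses the complete sums as a Dirichlet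
convolution of `ψ` with the Ramanujan sums. -/
lemma completeSum_eq_convolution [NeZero N] (ψ : DirichletCharacter ℂ N) (m : ℤ) {q : ℕ}
    (hq : q ≠ 0) :
    completeSum ψ m (N * q) =
      LSeries.convolution (fun g : ℕ ↦ ψ (g : ZMod N)) (fun k ↦ ramanujanSum ψ m (N * k)) q := by
  have hN : 0 < N := Nat.pos_of_ne_zero (NeZero.ne N)
  rw [LSeries.convolution_def]
  dsimp only
  rw [Nat.sum_divisorsAntidiagonal fun g k ↦ ψ (g : ZMod N) * ramanujanSum ψ m (N * k),
    completeSum, ← Finset.sum_fiberwise_of_maps_to (s := Finset.range (N * q)) (t := q.divisors)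
      (g := fun d ↦ Nat.gcd d q) fun d _ ↦ Nat.mem_divisors.mpr ⟨Nat.gcd_dvd_right _ _, hq⟩]
  refine Finset.sum_congr rfl fun g hg ↦ ?_
  obtain ⟨k, rfl⟩ := (Nat.mem_divisors.mp hg).1
  have hg0 : 0 < g := Nat.pos_of_ne_zero fun h ↦ hq (by simp [h])
  rw [Nat.mul_div_cancel_left _ hg0]
  -- Coprimality to `N` need not be imposed on `d`, as `ψ` vanishes otherwise.
  have hram : ramanujanSum ψ m (N * k) =
      ∑ d ∈ (Finset.range (N * k)).filter (fun d ↦ Nat.gcd d k = 1),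
        ψ (d : ZMod N) * expFrac m d (N * k) := by
    rw [ramanujanSum]
    refine Finset.sum_subset (fun d hd ↦ ?_) fun d hd hd' ↦ ?_
    · rw [Finset.mem_filter] at hd ⊢
      exact ⟨hd.1, Nat.Coprime.coprime_mul_left_right hd.2⟩
    · rw [Finset.mem_filter] at hd hd'
      have : ¬ IsUnit (d : ZMod N) := by
        rw [ZMod.isUnit_iff_coprime]
        exact fun h ↦ hd' ⟨hd.1, Nat.Coprime.mul_right h hd.2⟩
      rw [ψ.map_nonunit this, zero_mul]
  rw [hram, Finset.mul_sum]
  symm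
  refine Finset.sum_nbij' (fun d ↦ g * d) (fun d ↦ d / g) ?_ ?_ ?_ ?_ ?_
  · intro d hd
    simp only [Finset.mem_filter, Finset.mem_range] at hd ⊢
    refine ⟨?_, by rw [Nat.gcd_mul_left, hd.2, mul_one]⟩
    calc g * d < g * (N * k) := Nat.mul_lt_mul_of_pos_left hd.1 hg0
      _ = N * (g * k) := by ring
  · intro d hd
    simp only [Finset.mem_filter, Finset.mem_range] at hd ⊢
    obtain ⟨e, rfl⟩ : g ∣ d := by rw [← hd.2]; exact Nat.gcd_dvd_left _ _
    rw [Nat.mul_div_cancel_left _ hg0]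
    refine ⟨?_, ?_⟩
    · refine Nat.lt_of_mul_lt_mul_left (a := g) ?_
      calc g * e < N * (g * k) := hd.1
        _ = g * (N * k) := by ring
    · have := hd.2
      rw [Nat.gcd_mul_left] at this
      exact Nat.eq_of_mul_eq_mul_left hg0 (by rw [this, mul_one])
  · intro d _
    exact Nat.mul_div_cancel_left _ hg0
  · intro d hd
    simp only [Finset.mem_filter, Finset.mem_range] at hd
    exact Nat.mul_div_cancel' (by rw [← hd.2]; exact Nat.gcd_dvd_left _ _)
  · intro d _
    rw [show N * (g * k) = g * (N * k) by ring, expFrac_mul_left _ _ _ _ hg0.ne']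
    push_cast
    rw [map_mul, mul_assoc]

/-- Otherwise the discrete Fourier transform of `ψ`, hence `ψ` itself, would vanish. -/
lemma gaussW_ne_zero [NeZero N] {ψ : DirichletCharacter ℂ N} (hψ : ψ.IsPrimitive) :
    gaussW ψ ≠ 0 := by
  intro h
  have h0 : ZMod.dft (ψ : ZMod N → ℂ) = 0 := by
    ext k
    rw [DirichletCharacter.IsPrimitive.fourierTransform_eq_inv_mul_gaussSum hψ k]
    rw [gaussW] at h
    rw [h, mul_zero, Pi.zero_apply]
  have h1 : (ψ : ZMod N → ℂ) = 0 := (LinearEquiv.map_eq_zero_iff _).mp h0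
  have := congrFun h1 1
  simp at this

end RamanujanSums

section RamanujanSeries

variable {N : ℕ}

lemma lseriesSummable_ramanujanSum (ψ : DirichletCharacter ℂ N) (m : ℤ) {w : ℂ} (hw : 2 < w.re) :
    LSeriesSummable (fun k ↦ ramanujanSum ψ m (N * k)) w := by
  refine LSeriesSummable_of_le_const_mul_rpow hw ⟨N, fun k _ ↦ ?_⟩
  have := norm_ramanujanSum_le ψ m (N * k)
  push_cast at this
  norm_num
  exact this

lemma isPrimitive_inv {χ : DirichletCharacter ℂ N} (hχ : χ.IsPrimitive) : χ⁻¹.IsPrimitive := by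
  rw [DirichletCharacter.isPrimitive_def, DirichletCharacter.conductor_inv]
  exact hχ

lemma map_intCast_eq_natAbs {χ : DirichletCharacter ℂ N} (hχ_even : χ (-1) = 1) (m : ℤ) :
    χ (m : ZMod N) = χ (m.natAbs : ZMod N) := by
  rcases Int.natAbs_eq m with h | h
  · conv_lhs => rw [h]
    simp
  · conv_lhs => rw [h]
    rw [Int.cast_neg, Int.cast_natCast, ← neg_one_mul, map_mul, hχ_even, one_mul]

/-- The Dirichlet series of complete sums is a finite sum over the divisors of `m`. -/
lemma LSeries_completeSum [NeZero N] {χ : DirichletCharacter ℂ N} (hχ : χ.IsPrimitive)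
    (hχ_even : χ (-1) = 1) {m : ℤ} (hm : m ≠ 0) (w : ℂ) :
    LSeries (fun q ↦ completeSum χ⁻¹ m (N * q)) w =
      gaussW χ⁻¹ * (twistedSigma χ (w - 1) m.natAbs / (m.natAbs : ℂ) ^ (w - 1)) := by
  have hM : m.natAbs ≠ 0 := Int.natAbs_ne_zero.mpr hm
  have hsupp : ∀ q ∉ m.natAbs.divisors,
      LSeries.term (fun q ↦ completeSum χ⁻¹ m (N * q)) w q = 0 := by
    intro q hq
    rcases eq_or_ne q 0 with rfl | hq0
    · simp
    rw [LSeries.term_of_ne_zero hq0, completeSum_mul (isPrimitive_inv hχ) m hq0, if_neg, zero_div]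
    exact fun h ↦ hq (Nat.mem_divisors.mpr ⟨Int.natCast_dvd.mp h, hM⟩)
  rw [LSeries, tsum_eq_sum hsupp, twistedSigma,
    ← Nat.sum_div_divisors m.natAbs fun d ↦ χ (d : ZMod N) * (d : ℂ) ^ (w - 1), Finset.sum_div,
    Finset.mul_sum]
  refine Finset.sum_congr rfl fun q hq ↦ ?_
  obtain ⟨e, he⟩ := (Nat.mem_divisors.mp hq).1
  have hq0 : q ≠ 0 := fun h ↦ hM (by simp [he, h])
  have he0 : e ≠ 0 := fun h ↦ hM (by simp [he, h])
  have hq0' : (q : ℂ) ≠ 0 := by exact_mod_cast hq0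
  have he0' : (e : ℂ) ≠ 0 := by exact_mod_cast he0
  have hdvd : (q : ℤ) ∣ m := Int.natCast_dvd.mpr ⟨e, he⟩
  have hdiv : (m / (q : ℤ)).natAbs = e := by
    obtain ⟨k, rfl⟩ := hdvd
    rw [Int.mul_ediv_cancel_left _ (by exact_mod_cast hq0)]
    rw [Int.natAbs_mul, Int.natAbs_natCast] at he
    exact Nat.eq_of_mul_eq_mul_left (Nat.pos_of_ne_zero hq0) he
  rw [LSeries.term_of_ne_zero hq0, completeSum_mul (isPrimitive_inv hχ) m hq0, if_pos hdvd, inv_inv,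
    map_intCast_eq_natAbs hχ_even, hdiv, he, Nat.mul_div_cancel_left _ (Nat.pos_of_ne_zero hq0)]
  have h1 : ((q * e : ℕ) : ℂ) ^ (w - 1) = (q : ℂ) ^ (w - 1) * (e : ℂ) ^ (w - 1) := by
    rw [Nat.cast_mul, natCast_mul_natCast_cpow]
  have h2 : (q : ℂ) ^ w = (q : ℂ) ^ (w - 1) * q := by
    rw [Complex.cpow_sub _ _ hq0', Complex.cpow_one, div_mul_cancel₀ _ hq0']
  have h3 : (q : ℂ) ^ (w - 1) ≠ 0 := by simp [Complex.cpow_eq_zero_iff, hq0']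
  have h4 : (e : ℂ) ^ (w - 1) ≠ 0 := by simp [Complex.cpow_eq_zero_iff, he0']
  rw [h1, h2]
  field_simp

/-- The expansion of the twisted divisor sum in Ramanujan sums. For `m = 0` both sides vanish when
`N ≠ 1`, because then `χ(0) = 0`. -/
lemma LFunction_mul_LSeries_ramanujanSum [NeZero N] {χ : DirichletCharacter ℂ N}
    (hχ : χ.IsPrimitive) (hχ_even : χ (-1) = 1) {m : ℤ} (hm : N ≠ 1 ∨ m ≠ 0) {w : ℂ} (hw : 2 < w.re) :
    DirichletCharacter.LFunction χ⁻¹ w * LSeries (fun k ↦ ramanujanSum χ⁻¹ m (N * k)) w =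
      gaussW χ⁻¹ * (twistedSigma χ (w - 1) m.natAbs / (m.natAbs : ℂ) ^ (w - 1)) := by
  have hw1 : 1 < w.re := by linarith
  rw [DirichletCharacter.LFunction_eq_LSeries _ hw1,
    ← LSeries_convolution' (DirichletCharacter.LSeriesSummable_of_one_lt_re χ⁻¹ hw1)
      (lseriesSummable_ramanujanSum χ⁻¹ m hw),
    ← LSeries_congr (fun {q} hq ↦ completeSum_eq_convolution χ⁻¹ m hq) w]
  by_cases h0 : m = 0
  · subst h0
    have hN : N ≠ 1 := by simpa using hm
    have hχ0 : χ (0 : ZMod N) = 0 := by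
      refine χ.map_nonunit fun h ↦ hN ?_
      have := (ZMod.isUnit_iff_coprime 0 N).mp (by simpa using h)
      simpa using this
    have hz : LSeries (fun q ↦ completeSum χ⁻¹ 0 (N * q)) w = LSeries (fun _ ↦ 0) w := by
      refine LSeries_congr (fun {q} hq ↦ ?_) w
      rw [completeSum_mul (isPrimitive_inv hχ) 0 hq, inv_inv, Int.zero_ediv, Int.cast_zero, hχ0]
      simp
    rw [hz]
    simp [twistedSigma, LSeries, LSeries.term_def]
  · exact LSeries_completeSum hχ hχ_even h0 w

end RamanujanSeries

/-! ### Completed additive twists -/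

section CompletedTwist

variable {N : ℕ} [NeZero N] (f : CuspFormsWeightTwo N)

lemma completedTwist_eq_mellin {N : ℕ} (f : CuspFormsWeightTwo N) (t : ℂ) (c d : ℕ) :
    completedTwist f t c d = (c : ℂ) ^ t * mellin (verticalLine f c d) t := by
  rw [completedTwist, mellin]
  congr 2
  ext x
  rw [smul_eq_mul, mul_comm]
  rfl

lemma exists_norm_verticalLine_le_rpow {A : ℝ} (hA : 1 ≤ A) :
    ∃ C : ℝ, 0 ≤ C ∧ ∀ c d : ℕ, ∀ x : ℝ, 0 < x → ‖verticalLine f c d x‖ ≤ C * x ^ (-A) := by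
  obtain ⟨C, hC, h⟩ := exists_norm_le_im_rpow_neg f hA
  refine ⟨C, hC, fun c d x hx ↦ ?_⟩
  have := h (verticalPoint c d hx)
  rwa [verticalPoint_im, ← verticalLine_eq] at this

/-- `f` is bounded near the cusp `-d / c` and decays rapidly towards `∞`, so its Mellin transform
along the vertical line is holomorphic on `Re t > 0`. -/
lemma differentiableAt_mellin_verticalLine {c d : ℕ} (hc : 0 < c) (hN : N ∣ c)
    (hcd : Nat.Coprime d c) {t : ℂ} (ht : 0 < t.re) :
    DifferentiableAt ℂ (mellin (verticalLine f c d)) t := by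
  obtain ⟨C, hC, h⟩ := exists_norm_verticalLine_le_rpow f (A := t.re + 1) (by linarith)
  obtain ⟨C', hC', h'⟩ := exists_norm_verticalLine_le_sq f
  refine mellin_differentiableAt_of_isBigO_rpow (a := t.re + 1) (b := 0)
    ((continuousOn_verticalLine f c d).locallyIntegrableOn measurableSet_Ioi) ?_ (by linarith) ?_ ht
  · refine IsBigO.of_bound C ?_
    filter_upwards [eventually_gt_atTop 0] with x hx
    rw [Real.norm_of_nonneg (by positivity)]
    exact h c d x hx
  · refine IsBigO.of_bound (C' * c ^ 2) ?_
    filter_upwards [self_mem_nhdsWithin] with x hx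
    simpa using h' c d hc hN hcd x hx

/-- Bound for the Mellin transform, uniform in the strip `ε ≤ Re t ≤ R` and in the cusp: use
`f = O(c²)` for heights `x ≤ 1` and `f = O(x^{-R-1})` for `x ≥ 1`. -/
lemma exists_norm_mellin_verticalLine_le {ε R : ℝ} (hε : 0 < ε) (hR : 0 ≤ R) :
    ∃ K : ℝ, 0 ≤ K ∧ ∀ c d : ℕ, 0 < c → N ∣ c → Nat.Coprime d c → ∀ t : ℂ, ε ≤ t.re → t.re ≤ R →
      ‖mellin (verticalLine f c d) t‖ ≤ K * (c : ℝ) ^ 2 := by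
  obtain ⟨C, hC, h⟩ := exists_norm_verticalLine_le_rpow f (A := R + 1) (by linarith)
  obtain ⟨C', hC', h'⟩ := exists_norm_verticalLine_le_sq f
  set u : ℝ → ℝ := fun x ↦ if x ≤ 1 then x ^ (ε - 1) else x ^ (-2 : ℝ) with hu
  have hu0 : ∀ x ∈ Set.Ioi (0 : ℝ), 0 ≤ u x := by
    intro x (hx : 0 < x)
    rw [hu]
    dsimp only
    split_ifs <;> positivity
  have hui : IntegrableOn u (Set.Ioi 0) := by
    rw [← Set.Ioc_union_Ioi_eq_Ioi zero_le_one]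
    refine IntegrableOn.union ?_ ?_
    · have h1 : IntegrableOn (fun x : ℝ ↦ x ^ (ε - 1)) (Set.Ioc 0 1) :=
        (intervalIntegrable_iff_integrableOn_Ioc_of_le zero_le_one).mp
          (intervalIntegral.intervalIntegrable_rpow' (by linarith))
      refine h1.congr_fun (fun x hx ↦ ?_) measurableSet_Ioc
      rw [hu]
      dsimp only
      rw [if_pos hx.2]
    · refine (integrableOn_Ioi_rpow_of_lt (a := -2) (by norm_num) zero_lt_one).congr_fun
        (fun x hx ↦ ?_) measurableSet_Ioi
      rw [hu]
      dsimp only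
      rw [if_neg (not_le.mpr hx)]
  refine ⟨(C + C') * ∫ x in Set.Ioi 0, u x, mul_nonneg (by positivity)
    (setIntegral_nonneg measurableSet_Ioi hu0), fun c d hc hN hcd t ht htR ↦ ?_⟩
  have hc1 : (1 : ℝ) ≤ (c : ℝ) ^ 2 := one_le_pow₀ (by exact_mod_cast hc)
  have hbound : ∀ x ∈ Set.Ioi (0 : ℝ), ‖(x : ℂ) ^ (t - 1) • verticalLine f c d x‖ ≤
      (C + C') * (c : ℝ) ^ 2 * u x := by
    intro x (hx : 0 < x)
    rw [norm_smul, norm_cpow_eq_rpow_re_of_pos hx, sub_re, one_re, hu]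
    dsimp only
    split_ifs with hx1
    · calc x ^ (t.re - 1) * ‖verticalLine f c d x‖ ≤ x ^ (ε - 1) * (C' * (c : ℝ) ^ 2) := by
            refine mul_le_mul ?_ (h' c d hc hN hcd x hx) (norm_nonneg _) (by positivity)
            exact Real.rpow_le_rpow_of_exponent_ge hx hx1 (by linarith)
        _ ≤ x ^ (ε - 1) * ((C + C') * (c : ℝ) ^ 2) := by gcongr; linarith
        _ = _ := by ring
    · have hx1' : 1 ≤ x := (not_le.mp hx1).le
      calc x ^ (t.re - 1) * ‖verticalLine f c d x‖ ≤ x ^ (R - 1) * (C * x ^ (-(R + 1))) := by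
            refine mul_le_mul ?_ (h c d x hx) (norm_nonneg _) (by positivity)
            exact Real.rpow_le_rpow_of_exponent_le hx1' (by linarith)
        _ = C * x ^ (-2 : ℝ) := by
            rw [mul_left_comm, ← Real.rpow_add hx]; congr 2; ring
        _ ≤ (C + C') * (c : ℝ) ^ 2 * x ^ (-2 : ℝ) := by
            gcongr
            nlinarith
  rw [mellin]
  refine (norm_integral_le_of_norm_le (hui.const_mul ((C + C') * (c : ℝ) ^ 2))
    ((ae_restrict_iff' measurableSet_Ioi).mpr (Eventually.of_forall hbound))).trans (le_of_eq ?_)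
  rw [integral_const_mul]
  ring

/-- In the region of absolute convergence the Mellin transform along the vertical line above
`-d / c` is the Dirichlet series of `f` twisted by `e(-ld/c)`. -/
lemma hasSum_mellin_verticalLine (c d : ℕ) {t : ℂ} (ht : 3 / 2 < t.re) :
    HasSum (fun l : ℕ ↦ Gamma t / (2 * Real.pi : ℂ) ^ t *
      (fourierCoeff f l / (l : ℂ) ^ t * expFrac (-l) d c)) (mellin (verticalLine f c d) t) := by
  have hmain := hasSum_mellin (a := fun l : ℕ ↦ fourierCoeff f l * expFrac (-l) d c)
    (p := fun l : ℕ ↦ 2 * Real.pi * l) (F := verticalLine f c d) (s := t) ?_ (by linarith) ?_ ?_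
  · refine hmain.congr_fun fun l ↦ ?_
    have : ((2 * Real.pi * l : ℝ) : ℂ) ^ t = (2 * Real.pi : ℂ) ^ t * (l : ℂ) ^ t := by
      rw [ofReal_mul, mul_cpow_ofReal_nonneg (by positivity) (by positivity)]
      push_cast
      rfl
    rw [this]
    ring
  · intro l
    rcases Nat.eq_zero_or_pos l with rfl | hl
    · left; rw [fourierCoeff_zero, zero_mul]
    · right; positivity
  · intro x (hx : 0 < x)
    have h := ModularForm.hasSum_qExpansion f one_pos (one_mem_strictPeriods_Gamma0 N)
      (verticalPoint c d hx)
    rw [← verticalLine_eq] at h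
    refine h.congr_fun fun l ↦ ?_
    rw [fourierCoeff, mul_assoc]
    congr 1
    rw [Function.Periodic.qParam, ← Complex.exp_nat_mul, expFrac, ofReal_exp, ← Complex.exp_add]
    congr 1
    simp only [verticalPoint]
    push_cast
    ring_nf
    simp only [I_sq]
    ring
  · have := (summable_norm_fourierCoeff_div_rpow f ht).mul_left (((2 * Real.pi) ^ t.re)⁻¹)
    refine this.congr fun l ↦ ?_
    rw [norm_mul, norm_expFrac, mul_one, Real.mul_rpow (x := 2 * Real.pi) (y := l) (by positivity) (by positivity), ← div_div,
      div_eq_inv_mul _ ((2 * Real.pi) ^ t.re), mul_div_assoc]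

end CompletedTwist

/-! ### The sum over the moduli and the shifted convolution series -/

section ModulusSeries

variable {N : ℕ} (f : CuspFormsWeightTwo N) (χ : DirichletCharacter ℂ N) (n : ℤ)

/-- The factor `c^t` of the completed twists cancels the `c^{-t}` of the term. -/
lemma modulusTerm_eq [NeZero N] (s t : ℂ) {c : ℕ} (hc : c ≠ 0) :
    modulusTerm f χ n s t c = (c : ℂ) ^ (-2 * s) *
      ∑ d ∈ (Finset.range c).filter (fun d => Nat.Coprime d c),
        χ⁻¹ (d : ZMod N) * expFrac n d c * mellin (verticalLine f c d) t := by
  have hc' : (c : ℂ) ≠ 0 := by exact_mod_cast hc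
  have hpow : (c : ℂ) ^ (-2 * s) = (c : ℂ) ^ (-2 * s - t) * (c : ℂ) ^ t := by
    rw [← Complex.cpow_add _ _ hc']; congr 1; ring
  rw [modulusTerm, hpow, mul_assoc _ ((c : ℂ) ^ t)]
  congr 1
  rw [Finset.mul_sum]
  refine Finset.sum_congr rfl fun d _ ↦ ?_
  have hstar : (starRingEnd ℂ) (χ (d : ZMod N)) = χ⁻¹ (d : ZMod N) := by
    rw [← MulChar.star_eq_inv, MulChar.star_apply]; rfl
  rw [completedTwist_eq_mellin, hstar, expFrac]
  ring

lemma modulusTerm_zero (s t : ℂ) : modulusTerm f χ n s t 0 = 0 := by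
  simp [modulusTerm]

/-- The majorant `c^{3 - 2 Re s}` comes from `c^{-2 Re s}`, at most `c` residues `d`, and `c²` from
the Mellin transforms; it is summable exactly when `Re s > 2`. -/
lemma exists_norm_modulusTerm_le [NeZero N] (s : ℂ) {ε R : ℝ} (hε : 0 < ε) (hR : 0 ≤ R) :
    ∃ K : ℝ, 0 ≤ K ∧ ∀ c : Modulus N, ∀ t : ℂ, ε ≤ t.re → t.re ≤ R →
      ‖modulusTerm f χ n s t c.1‖ ≤ K * ((c.1 : ℝ) ^ (3 - 2 * s.re)) := by
  obtain ⟨K, hK, h⟩ := exists_norm_mellin_verticalLine_le f hε hR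
  refine ⟨K, hK, fun ⟨c, hc, hN⟩ t ht htR ↦ ?_⟩
  have hc' : (0 : ℝ) < c := by exact_mod_cast hc
  dsimp only
  rw [modulusTerm_eq f χ n s t hc.ne', norm_mul, norm_natCast_cpow_of_pos hc]
  have hsum : ‖∑ d ∈ (Finset.range c).filter (fun d => Nat.Coprime d c),
      χ⁻¹ (d : ZMod N) * expFrac n d c * mellin (verticalLine f c d) t‖ ≤
      c * (K * (c : ℝ) ^ 2) := by
    refine (norm_sum_le_of_le _ (n := fun _ ↦ K * (c : ℝ) ^ 2) fun d hd ↦ ?_).trans ?_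
    · rw [norm_mul, norm_mul, norm_expFrac, mul_one]
      refine (mul_le_of_le_one_left (norm_nonneg _) (χ⁻¹.norm_le_one _)).trans ?_
      exact h c d hc hN (Finset.mem_filter.mp hd).2 t ht htR
    · rw [Finset.sum_const, nsmul_eq_mul]
      gcongr
      exact (Finset.card_filter_le _ _).trans (Finset.card_range c).le
  calc (c : ℝ) ^ (-2 * s).re * _ ≤ (c : ℝ) ^ (-2 * s).re * (c * (K * (c : ℝ) ^ 2)) := by gcongr
    _ = K * ((c : ℝ) ^ (-2 * s).re * (c : ℝ) ^ (3 : ℝ)) := by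
        rw [show (3 : ℝ) = ((3 : ℕ) : ℝ) by norm_num, Real.rpow_natCast]; ring
    _ = K * (c : ℝ) ^ (3 - 2 * s.re) := by
        rw [← Real.rpow_add hc']
        congr 2
        simp
        ring

lemma summable_modulus_rpow (N : ℕ) {s : ℂ} (hs : 2 < s.re) :
    Summable fun c : Modulus N ↦ (c.1 : ℝ) ^ (3 - 2 * s.re) :=
  (Real.summable_nat_rpow.mpr (by linarith)).comp_injective Subtype.val_injective

lemma summable_modulusTerm [NeZero N] {s t : ℂ} (hs : 2 < s.re) (ht : 0 < t.re) :
    Summable fun c : Modulus N ↦ modulusTerm f χ n s t c.1 := by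
  obtain ⟨K, -, h⟩ := exists_norm_modulusTerm_le f χ n s ht ht.le
  exact Summable.of_norm_bounded ((summable_modulus_rpow N hs).mul_left K)
    fun c ↦ h c t le_rfl le_rfl

lemma differentiableOn_tsum_modulusTerm [NeZero N] {s : ℂ} (hs : 2 < s.re) :
    DifferentiableOn ℂ (fun t ↦ ∑' c : Modulus N, modulusTerm f χ n s t c.1) {t | 0 < t.re} := by
  intro t₀ (ht₀ : 0 < t₀.re)
  obtain ⟨K, -, h⟩ := exists_norm_modulusTerm_le f χ n s (ε := t₀.re / 2) (R := t₀.re + 1)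
    (by positivity) (by positivity)
  set U : Set ℂ := {t | t₀.re / 2 < t.re} ∩ {t | t.re < t₀.re + 1} with hU
  have hUo : IsOpen U := (isOpen_lt continuous_const continuous_re).inter
    (isOpen_lt continuous_re continuous_const)
  have hmem : t₀ ∈ U := ⟨by simp [ht₀], by simp⟩
  have hd : DifferentiableOn ℂ (fun t ↦ ∑' c : Modulus N, modulusTerm f χ n s t c.1) U := by
    refine differentiableOn_tsum_of_summable_norm ((summable_modulus_rpow N hs).mul_left K)
      (fun ⟨c, hc, hN⟩ t ht ↦ ?_) hUo fun c t ht ↦ h c t ht.1.le ht.2.le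
    have ht0 : 0 < t.re := lt_trans (by positivity) ht.1
    simp_rw [modulusTerm_eq f χ n s _ hc.ne']
    refine DifferentiableAt.differentiableWithinAt ?_
    refine DifferentiableAt.const_mul (DifferentiableAt.fun_sum fun d hd ↦ ?_) _
    exact (differentiableAt_mellin_verticalLine f hc hN (Finset.mem_filter.mp hd).2 ht0).const_mul _
  exact (hd.differentiableAt (hUo.mem_nhds hmem)).differentiableWithinAt

/-- The moduli are the multiples `N q` with `q ≥ 1`; the term `q = 0` is harmless as `g 0 = 0`. -/
lemma tsum_modulus {M : Type*} [AddCommMonoid M] [TopologicalSpace M] [NeZero N] (g : ℕ → M)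
    (hg : g 0 = 0) : ∑' c : Modulus N, g c.1 = ∑' q : ℕ, g (N * q) := by
  have hN : 0 < N := Nat.pos_of_ne_zero (NeZero.ne N)
  have hinj : Function.Injective fun q : ℕ ↦ N * q := fun a b h ↦ Nat.eq_of_mul_eq_mul_left hN h
  rw [show ∑' c : Modulus N, g c.1 = ∑' c : ({c : ℕ | 0 < c ∧ N ∣ c} : Set ℕ), g c from rfl,
    tsum_subtype, ← hinj.tsum_eq]
  · refine tsum_congr fun q ↦ ?_
    rcases Nat.eq_zero_or_pos q with rfl | hq
    · simp [hg]
    · exact Set.indicator_of_mem (s := {c : ℕ | 0 < c ∧ N ∣ c})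
        ⟨Nat.mul_pos hN hq, Nat.dvd_mul_right _ _⟩ g
  · intro c hc
    obtain ⟨q, rfl⟩ := (Set.mem_of_indicator_ne_zero hc).2
    exact ⟨q, rfl⟩

/-- For `Re t > 3/2` the Dirichlet series of the additive twists assemble to Ramanujan sums. -/
lemma hasSum_modulusTerm [NeZero N] (s : ℂ) {t : ℂ} (ht : 3 / 2 < t.re) {q : ℕ} (hq : q ≠ 0) :
    HasSum (fun l : ℕ ↦ Gamma t / (2 * Real.pi : ℂ) ^ t * (N : ℂ) ^ (-2 * s) *
      (fourierCoeff f l / (l : ℂ) ^ t *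
        LSeries.term (fun k ↦ ramanujanSum χ⁻¹ (n - l) (N * k)) (2 * s) q))
      (modulusTerm f χ n s t (N * q)) := by
  rw [modulusTerm_eq f χ n s t (mul_ne_zero (NeZero.ne N) hq)]
  have h := (hasSum_sum (s := (Finset.range (N * q)).filter fun d => Nat.Coprime d (N * q))
    fun d _ ↦ (hasSum_mellin_verticalLine f (N * q) d ht).mul_left
      (χ⁻¹ (d : ZMod N) * expFrac n d (N * q))).mul_left (((N * q : ℕ) : ℂ) ^ (-2 * s))
  refine h.congr_fun fun l ↦ ?_
  have hpow : ((N * q : ℕ) : ℂ) ^ (-2 * s) = (N : ℂ) ^ (-2 * s) * ((q : ℂ) ^ (2 * s))⁻¹ := by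
    rw [Nat.cast_mul, natCast_mul_natCast_cpow, ← Complex.cpow_neg, neg_mul]
  have hexp (d : ℕ) : expFrac (n - l) d (N * q) =
      expFrac n d (N * q) * expFrac (-l) d (N * q) := by
    rw [expFrac, expFrac, expFrac, ← Complex.exp_add]
    congr 1
    push_cast
    ring
  rw [LSeries.term_of_ne_zero hq, ramanujanSum, hpow, Finset.sum_div, Finset.mul_sum,
    Finset.mul_sum, Finset.mul_sum]
  refine Finset.sum_congr rfl fun d _ ↦ ?_
  rw [hexp]
  ring

/-- Interchange of the absolutely convergent sums over `c = N q` and `l`. -/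
lemma tsum_modulusTerm [NeZero N] {s t : ℂ} (hs : 2 < s.re) (ht : 3 / 2 < t.re) :
    ∑' c : Modulus N, modulusTerm f χ n s t c.1 =
      Gamma t / (2 * Real.pi : ℂ) ^ t * (N : ℂ) ^ (-2 * s) *
        ∑' l : ℕ, fourierCoeff f l / (l : ℂ) ^ t *
          LSeries (fun k ↦ ramanujanSum χ⁻¹ (n - l) (N * k)) (2 * s) := by
  set G : ℕ → ℕ → ℂ := fun q l ↦ fourierCoeff f l / (l : ℂ) ^ t *
    LSeries.term (fun k ↦ ramanujanSum χ⁻¹ (n - l) (N * k)) (2 * s) q with hG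
  have hs2 : (2 * s).re = 2 * s.re := by simp
  have hu : Summable fun q : ℕ ↦ (N : ℝ) * (q : ℝ) ^ (1 - 2 * s.re) :=
    (Real.summable_nat_rpow.mpr (by linarith)).mul_left _
  have hGle (q l : ℕ) : ‖G q l‖ ≤
      (N : ℝ) * (q : ℝ) ^ (1 - 2 * s.re) * (‖fourierCoeff f l‖ / (l : ℝ) ^ t.re) := by
    rw [hG]
    dsimp only
    rcases Nat.eq_zero_or_pos l with rfl | hl
    · simp [fourierCoeff_zero]
    rcases Nat.eq_zero_or_pos q with rfl | hq
    · rw [LSeries.term_zero, mul_zero, norm_zero]; positivity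
    have hq' : (0 : ℝ) < q := by exact_mod_cast hq
    rw [norm_mul, norm_div, norm_natCast_cpow_of_pos hl, mul_comm, LSeries.norm_term_eq,
      if_neg hq.ne', hs2]
    gcongr
    rw [Real.rpow_sub hq', Real.rpow_one, ← mul_div_assoc]
    gcongr
    exact_mod_cast norm_ramanujanSum_le χ⁻¹ (n - l) (N * q)
  have hsum : Summable (Function.uncurry G) := by
    refine Summable.of_norm_bounded (hu.mul_of_nonneg (summable_norm_fourierCoeff_div_rpow f ht)
      (fun q ↦ by positivity) (fun l ↦ by positivity)) fun p ↦ hGle p.1 p.2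
  rw [tsum_modulus _ (modulusTerm_zero f χ n s t)]
  have hrow (q : ℕ) : modulusTerm f χ n s t (N * q) =
      Gamma t / (2 * Real.pi : ℂ) ^ t * (N : ℂ) ^ (-2 * s) * ∑' l : ℕ, G q l := by
    rcases eq_or_ne q 0 with rfl | hq
    · rw [mul_zero, modulusTerm_zero]
      simp [hG]
    · rw [← (hasSum_modulusTerm f χ n s ht hq).tsum_eq, tsum_mul_left]
  simp_rw [hrow]
  rw [tsum_mul_left, ← hsum.tsum_comm]
  congr 1
  refine tsum_congr fun l ↦ ?_
  rw [hG, tsum_mul_left, LSeries]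

variable {χ} in
/-- Each term of the shifted convolution series as an `L`-series of Ramanujan sums. For `l = n` the
two sides vanish if `N ≠ 1`; for `N = 1` there are no nonzero cusp forms of weight two. -/
lemma shiftedTerm_eq [NeZero N] (hχ : χ.IsPrimitive) (hχ_even : χ (-1) = 1) {s : ℂ}
    (hs : 2 < s.re) (t : ℂ) (l : ℕ) :
    shiftedTerm f χ s t l (l - n) = fourierCoeff f l / (l : ℂ) ^ t *
      (DirichletCharacter.LFunction χ⁻¹ (2 * s) / gaussW χ⁻¹ *
        LSeries (fun k ↦ ramanujanSum χ⁻¹ (n - l) (N * k)) (2 * s)) := by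
  have habs : (n - (l : ℤ)).natAbs = ((l : ℤ) - n).natAbs := by
    rw [← Int.natAbs_neg, neg_sub]
  have hW := gaussW_ne_zero (isPrimitive_inv hχ)
  rw [shiftedTerm]
  by_cases h : N ≠ 1 ∨ n - (l : ℤ) ≠ 0
  · have hs2 : 2 < (2 * s).re := by simp; linarith
    have key := LFunction_mul_LSeries_ramanujanSum hχ hχ_even h hs2
    rw [habs] at key
    rw [div_mul_eq_mul_div (DirichletCharacter.LFunction _ _), key, mul_div_cancel_left₀ _ hW]
    ring
  · have hN : N = 1 := by by_contra h'; exact h (Or.inl h')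
    subst hN
    rw [fourierCoeff_eq_zero_of_level_one]
    simp

variable {χ} in
/-- The normalized divisor sums `σ(|m|) / |m|^{2s-1}` are bounded uniformly in `m`, by their expansion
in Ramanujan sums, so the series is dominated by `∑ |a(l)| l^{-Re t}`. -/
lemma summable_norm_shiftedTerm [NeZero N] (hχ : χ.IsPrimitive) (hχ_even : χ (-1) = 1) {s t : ℂ}
    (hs : 2 < s.re) (ht : 3 / 2 < t.re) :
    Summable fun l : ℕ ↦ ‖shiftedTerm f χ s t l (l - n)‖ := by
  set A : ℂ := DirichletCharacter.LFunction χ⁻¹ (2 * s) / gaussW χ⁻¹ with hA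
  have hs2 : (2 * s).re = 2 * s.re := by simp
  have hu : Summable fun q : ℕ ↦ (N : ℝ) * (q : ℝ) ^ (1 - 2 * s.re) :=
    (Real.summable_nat_rpow.mpr (by linarith)).mul_left _
  set B : ℝ := ∑' q : ℕ, (N : ℝ) * (q : ℝ) ^ (1 - 2 * s.re) with hB
  have hL (m : ℤ) : ‖LSeries (fun k ↦ ramanujanSum χ⁻¹ m (N * k)) (2 * s)‖ ≤ B := by
    refine tsum_of_norm_bounded hu.hasSum fun q ↦ ?_
    rcases Nat.eq_zero_or_pos q with rfl | hq
    · rw [LSeries.term_zero, norm_zero]; positivity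
    have hq' : (0 : ℝ) < q := by exact_mod_cast hq
    rw [LSeries.norm_term_eq, if_neg hq.ne', hs2, Real.rpow_sub hq', Real.rpow_one,
      ← mul_div_assoc]
    gcongr
    exact_mod_cast norm_ramanujanSum_le χ⁻¹ m (N * q)
  refine Summable.of_nonneg_of_le (fun _ ↦ norm_nonneg _) (fun l ↦ ?_)
    ((summable_norm_fourierCoeff_div_rpow f ht).mul_right (‖A‖ * B))
  rw [shiftedTerm_eq f n hχ hχ_even hs t l, norm_mul, norm_mul]
  rcases Nat.eq_zero_or_pos l with rfl | hl
  · simp [fourierCoeff_zero]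
  rw [norm_div, norm_natCast_cpow_of_pos hl]
  gcongr
  exact hL _

end ModulusSeries

/-- A pair `(l, m)` with `l - m = n` is determined by `l`. -/
def shiftPairEquiv (n : ℤ) : ShiftPair n ≃ {l : ℕ // 1 ≤ l ∧ (l : ℤ) ≠ n} where
  toFun p := ⟨p.1.1, p.2.1, fun h ↦ p.2.2.1 (by have := p.2.2.2; omega)⟩
  invFun l := ⟨(l.1, (l.1 : ℤ) - n), l.2.1, sub_ne_zero.mpr l.2.2, by simp⟩
  left_inv p := by
    have := p.2.2.2
    ext
    · rfl
    · simp only; omega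
  right_inv l := rfl

lemma shiftedTerm_shiftPair {N : ℕ} (f : CuspFormsWeightTwo N) (χ : DirichletCharacter ℂ N)
    (n : ℤ) (s t : ℂ) (p : ShiftPair n) :
    shiftedTerm f χ s t p.1.1 p.1.2 =
      shiftedTerm f χ s t (shiftPairEquiv n p).1 (((shiftPairEquiv n p).1 : ℤ) - n) := by
  have := p.2.2.2
  have h : p.1.2 = (p.1.1 : ℤ) - n := by omega
  rw [h]
  rfl

/-- The omitted terms vanish: `a(0) = 0`, and the divisor sum over `Nat.divisors 0 = ∅` is zero. -/
lemma tsum_shiftedTerm_eq_tsum_nat {N : ℕ} (f : CuspFormsWeightTwo N)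
    (χ : DirichletCharacter ℂ N) (n : ℤ) (s t : ℂ) :
    ∑' l : {l : ℕ // 1 ≤ l ∧ (l : ℤ) ≠ n}, shiftedTerm f χ s t l.1 ((l.1 : ℤ) - n) =
      ∑' l : ℕ, shiftedTerm f χ s t l (l - n) := by
  refine tsum_subtype_eq_of_support_subset (f := fun l : ℕ ↦ shiftedTerm f χ s t l (l - n))
    (s := {l : ℕ | 1 ≤ l ∧ (l : ℤ) ≠ n}) fun l hl ↦ ?_
  by_contra h
  refine hl ?_
  rcases Nat.eq_zero_or_pos l with rfl | hl0
  · simp [shiftedTerm, fourierCoeff_zero]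
  · have : (l : ℤ) = n := by
      by_contra h'
      exact h ⟨hl0, h'⟩
    simp [shiftedTerm, this, twistedSigma]

end ShiftedConvolution

theorem mainTheorem4 (N : ℕ) [NeZero N] (f : ShiftedConvolution.CuspFormsWeightTwo N)
    (χ : DirichletCharacter ℂ N) (hχ : χ.IsPrimitive) (hχ_even : χ (-1) = 1)
    (n : ℤ) (s : ℂ) (hs : 2 < s.re) :
    (∀ t : ℂ, 3 / 2 < t.re →
      Summable (fun p : ShiftedConvolution.ShiftPair n =>
        ‖ShiftedConvolution.shiftedTerm f χ s t p.1.1 p.1.2‖) ∧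
      ∑' p : ShiftedConvolution.ShiftPair n,
          ShiftedConvolution.shiftedTerm f χ s t p.1.1 p.1.2 =
        ∑' l : {l : ℕ // 1 ≤ l ∧ (l : ℤ) ≠ n},
          ShiftedConvolution.shiftedTerm f χ s t l.1 ((l.1 : ℤ) - n)) ∧
    ∃ δ : ℝ, 0 < δ ∧ ∃ D : ℂ → ℂ,
      AnalyticOnNhd ℂ D {t : ℂ | 1 / 2 - δ < t.re} ∧
      (∀ t : ℂ, 3 / 2 < t.re →
        D t = ∑' p : ShiftedConvolution.ShiftPair n,
          ShiftedConvolution.shiftedTerm f χ s t p.1.1 p.1.2) ∧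
      ∀ t : ℂ, 1 / 2 - δ < t.re →
        Summable (fun c : ShiftedConvolution.Modulus N =>
          ShiftedConvolution.modulusTerm f χ n s t c.1) ∧
        D t = (N : ℂ) ^ (2 * s) *
            (DirichletCharacter.LFunction χ⁻¹ (2 * s) / ShiftedConvolution.gaussW χ⁻¹) *
            ((2 * Real.pi : ℂ) ^ t / Complex.Gamma t) *
          ∑' c : ShiftedConvolution.Modulus N,
            ShiftedConvolution.modulusTerm f χ n s t c.1 := by
  have hpair (t : ℂ) : ∑' p : ShiftedConvolution.ShiftPair n,
      ShiftedConvolution.shiftedTerm f χ s t p.1.1 p.1.2 =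
      ∑' l : {l : ℕ // 1 ≤ l ∧ (l : ℤ) ≠ n},
        ShiftedConvolution.shiftedTerm f χ s t l.1 ((l.1 : ℤ) - n) := by
    simp_rw [ShiftedConvolution.shiftedTerm_shiftPair f χ n s t]
    exact (ShiftedConvolution.shiftPairEquiv n).tsum_eq
      (fun l ↦ ShiftedConvolution.shiftedTerm f χ s t l.1 ((l.1 : ℤ) - n))
  -- The sum over the moduli converges for `Re t > 0`, so `δ = 1 / 2` is admissible, and the
  -- continuation is defined by the right-hand side of the asserted formula.
  refine ⟨fun t ht ↦ ⟨?_, hpair t⟩, 1 / 2, by norm_num, fun t ↦ (N : ℂ) ^ (2 * s) *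
    (DirichletCharacter.LFunction χ⁻¹ (2 * s) / ShiftedConvolution.gaussW χ⁻¹) *
    ((2 * Real.pi : ℂ) ^ t / Complex.Gamma t) *
    ∑' c : ShiftedConvolution.Modulus N, ShiftedConvolution.modulusTerm f χ n s t c.1, ?_,
    fun t ht ↦ ?_, fun t ht ↦ ⟨?_, rfl⟩⟩
  · simp_rw [ShiftedConvolution.shiftedTerm_shiftPair f χ n s t]
    exact (ShiftedConvolution.summable_norm_shiftedTerm f n hχ hχ_even hs ht).comp_injective
      (Subtype.val_injective.comp (ShiftedConvolution.shiftPairEquiv n).injective)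
  · rw [show {t : ℂ | (1 : ℝ) / 2 - 1 / 2 < t.re} = {t : ℂ | 0 < t.re} by simp]
    refine DifferentiableOn.analyticOnNhd ?_ (isOpen_lt continuous_const continuous_re)
    refine DifferentiableOn.mul (DifferentiableOn.const_mul ?_ _)
      (ShiftedConvolution.differentiableOn_tsum_modulusTerm f χ n hs)
    refine Differentiable.differentiableOn ?_
    simp_rw [div_eq_mul_inv]
    have h2π : (2 * Real.pi : ℂ) ≠ 0 := by simp [Real.pi_ne_zero]
    exact Differentiable.mul (differentiable_id.const_cpow (Or.inl h2π))
      Complex.differentiable_one_div_Gamma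
  · have hΓ : Complex.Gamma t ≠ 0 := Complex.Gamma_ne_zero_of_re_pos (by linarith)
    have h2π : (2 * Real.pi : ℂ) ^ t ≠ 0 := by simp [Complex.cpow_eq_zero_iff, Real.pi_ne_zero]
    have hN : (N : ℂ) ^ (2 * s) ≠ 0 := by simp [Complex.cpow_eq_zero_iff, NeZero.ne N]
    rw [hpair, ShiftedConvolution.tsum_shiftedTerm_eq_tsum_nat]
    simp_rw [ShiftedConvolution.shiftedTerm_eq f n hχ hχ_even hs t,
      mul_left_comm (ShiftedConvolution.fourierCoeff f _ / _)]
    rw [tsum_mul_left]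
    rw [ShiftedConvolution.tsum_modulusTerm f χ n hs ht, neg_mul, Complex.cpow_neg]
    field_simp
  · exact ShiftedConvolution.summable_modulusTerm f χ n hs (by linarith)
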